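/- Let $d\ge 3$ and let $\mathbb T_d$ be the infinite tree in which every vertex has exactly $d$ neighbors; write $N(x)$ for the set of neighbors of $x$. For $\epsilon\in(0,1)$, the minus biased vote process with noise $\epsilon$ on $\mathbb T_d$ is the discrete-time process $\sigma(t)\in\{-1,1\}^{\mathbb T_d}$, $t=0,1,2,\dots$, with $\sigma_x(0)=1$ for all $x$, in which at each time $t\ge 1$, independently over all vertices and times, one of the following updates occurs at each vertex $x$: (1) with probability $1-\epsilon$, $\sigma_x(t)=-1$ if $|\{y\in N(x):\sigma_y(t-1)=-1\}|\ge 2$ and $\sigma_x(t)=1$ otherwise; (2) with probability $\epsilon$, $\sigma_x(t)$ is set to $-1$ or $1$ with probability $\tfrac12$ each. Theorem. For every $d\ge 3$ there are constants $c\in(0,\tfrac12)$ and $\epsilon_0\in(0,1)$, depending only on $d$, such that for every $\epsilon\in(0,\epsilon_0)$, every vertex $v$ of $\mathbb T_d$ and every time $t\ge 0$, $$\mathbb P(\sigma_v(t)=-1)\le c<\tfrac12 .$$ -/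

import Mathlib

open MeasureTheory ProbabilityTheory

namespace MinusBiasedVote

/-- A spin is an element of `{1, -1}`. -/
abbrev Spin : Type := ℤˣ

instance : MeasurableSingletonClass Spin :=
  ⟨fun s => ⟨{(s : ℤ)}, trivial, by ext x; simp [Units.ext_iff]⟩⟩

/-- The randomness used at one vertex at one time: a Boolean telling whether the update is a noise
update (`true`) or a minus bias update (`false`), and the spin that a noise update would write. -/
abbrev Update : Type := Bool × Spin

/-- The law of a single update: it is a noise update with probability `ε`, and independently of
this the noise spin is `1` or `-1` with probability one half each. -/
noncomputable def updateLaw (ε : unitInterval) : Measure Update :=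
  (bernoulliMeasure true false ε).prod (PMF.uniformOfFintype Spin).toMeasure

instance (ε : unitInterval) : IsProbabilityMeasure (updateLaw ε) := by
  unfold updateLaw; infer_instance

/-- The probability `ℙ` on the randomness of the whole process: the updates at all pairs
`(t, x)` of a time and a vertex are independent with law `updateLaw ε`. -/
noncomputable def processLaw (V : Type*) (ε : unitInterval) : Measure (ℕ × V → Update) :=
  Measure.infinitePi fun _ => updateLaw ε

instance (V : Type*) (ε : unitInterval) : IsProbabilityMeasure (processLaw V ε) := by
  unfold processLaw; infer_instance

open scoped Classical in
/-- The minus bias update at `x` from the configuration `s`: the new spin is `-1` if at least two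
neighbors of `x` have spin `-1`, and `1` otherwise. -/
noncomputable def biasUpdate {V : Type*} (G : SimpleGraph V) (s : V → Spin) (x : V) : Spin :=
  if 2 ≤ {y : V | G.Adj x y ∧ s y = -1}.encard then -1 else 1

/-- The minus biased vote process on `G` started from all plus, as a function of the randomness
`ω`: `process G ω t x` is the spin `σ_x(t)`. -/
noncomputable def process {V : Type*} (G : SimpleGraph V) (ω : ℕ × V → Update) : ℕ → V → Spin
  | 0 => fun _ => 1
  | t + 1 => fun x =>
      if (ω (t + 1, x)).1 then (ω (t + 1, x)).2 else biasUpdate G (process G ω t) x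

end MinusBiasedVote

/-!
A spin `-1` at a point `r` of space-time is caused by points with noise spin `-1`, each of which
has probability at most `ε`. A Peierls argument bounds the probability: one finds a connected
contour through `r` whose size is at most a constant times the number of noise points on it.

An *explanation* (`Explains`) is a finite set `X` of points containing `r`, each member of which is
a noise point or has two children in `X`, a child being a neighboring vertex one time step
earlier. It is moreover required to contain every point with two children in `X`. The minus spins
in the backward light cone of `r` form such a set (`exists_explains`); this uses that in a tree at
most one neighbor of a vertex is closer to a given vertex.

In an explanation with the fewest points no point has more than two children or more than two
parents (`Explains.exists_tight`), because otherwise a skin could be peeled off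
(`Explains.exists_ssubset`). The key is that if `b` at time `n` has two parents, then `b` at time
`n + 2` is in `X` and has the same two points as children. The four points form a diamond, and the
diamonds are glued along pairs of a parent and a child, at most two diamonds at each pair. So a
minimal explanation is a surface with singular points. The *boundary* consists of the pairs
bordering at most one diamond, and two facts make it a contour.

* Its size is at most a constant times the number of points with at most one child, all of which
  are noise points. This is a double count of the pairs of a parent and a child
  (`Tight.card_tops_le`, `Tight.card_boundaryPoints_le`).
* It is connected (`Tight.reflTransGen_of_mem_leaves`). A labelling that is constant along boundary
  pairs can be transported to all pairs, upwards through the columns of diamonds over an edge of the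
  graph. An induction on the time shows that the labels transported to a point all agree
  (`Tight.exists_label`), so that the labelling is constant on the boundary (`Tight.label_iff`).

A connected set of at most `10 * k` points is covered by a walk with `20 * k` moves
(`exists_visited`), and a union bound over the walks and over the sets of `k` noise points on them
gives a geometric series in a constant multiple of `ε` (`processLaw_process_eq_le`).
-/

namespace MinusBiasedVote

/-! ### Explanations of a minus spin -/

section Explanation

variable {V : Type*} {G : SimpleGraph V} {E : Set (ℕ × V)} {r : ℕ × V} {X : Finset (ℕ × V)}

open scoped Classical in
/-- The members of `X` that sit on a neighboring vertex one time step later than `z`. -/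
noncomputable def parents (G : SimpleGraph V) (X : Finset (ℕ × V)) (z : ℕ × V) :
    Finset (ℕ × V) :=
  {w ∈ X | w.1 = z.1 + 1 ∧ G.Adj w.2 z.2}

open scoped Classical in
/-- The members of `X` that sit on a neighboring vertex one time step earlier than `z`. -/
noncomputable def children (G : SimpleGraph V) (X : Finset (ℕ × V)) (z : ℕ × V) :
    Finset (ℕ × V) :=
  {w ∈ X | z.1 = w.1 + 1 ∧ G.Adj z.2 w.2}

/-- The same vertex two time steps later. -/
def above (z : ℕ × V) : ℕ × V := (z.1 + 2, z.2)

lemma mem_parents {z w : ℕ × V} :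
    w ∈ parents G X z ↔ w ∈ X ∧ w.1 = z.1 + 1 ∧ G.Adj w.2 z.2 := by
  simp [parents]

lemma mem_children {z w : ℕ × V} :
    w ∈ children G X z ↔ w ∈ X ∧ z.1 = w.1 + 1 ∧ G.Adj z.2 w.2 := by
  simp [children]

lemma mem_children_of_mem_parents {z w : ℕ × V} (hz : z ∈ X) (h : w ∈ parents G X z) :
    z ∈ children G X w :=
  mem_children.2 ⟨hz, (mem_parents.1 h).2⟩

lemma mem_parents_of_mem_children {z w : ℕ × V} (hz : z ∈ X) (h : w ∈ children G X z) :
    z ∈ parents G X w :=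
  mem_parents.2 ⟨hz, (mem_children.1 h).2⟩

lemma above_injective : Function.Injective (above : ℕ × V → ℕ × V) := by
  rintro ⟨m, x⟩ ⟨n, y⟩ h
  simpa [above] using h

lemma children_above (z : ℕ × V) : children G X (above z) = parents G X z := by
  ext w
  rw [mem_children, mem_parents]
  refine and_congr_right fun _ => and_congr ?_ (G.adj_comm _ _)
  simp only [above]
  omega

/-- `X` explains the spin `-1` at the space-time point `r` by the set `E` of points with noise spin
`-1`: every member of `X` is in `E` or has two children in `X`. The field `fill` asks in addition
that `X` contains every point of space-time two of whose earlier neighbors are in `X`. -/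
structure Explains (G : SimpleGraph V) (E : Set (ℕ × V)) (r : ℕ × V) (X : Finset (ℕ × V)) :
    Prop where
  root_mem : r ∈ X
  level_le : ∀ z ∈ X, z.1 ≤ r.1
  support : ∀ z ∈ X, z ∈ E ∨ 2 ≤ (children G X z).card
  fill : ∀ z, 2 ≤ (children G X z).card → z ∈ X

lemma Explains.parents_root (h : Explains G E r X) : parents G X r = ∅ := by
  refine Finset.eq_empty_of_forall_notMem fun w hw => ?_
  obtain ⟨hwX, hw1, -⟩ := mem_parents.1 hw
  have := h.level_le w hwX
  omega

lemma Explains.above_mem (h : Explains G E r X) {z : ℕ × V} (hz : 2 ≤ (parents G X z).card) :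
    above z ∈ X :=
  h.fill _ (by rwa [children_above])

/-- A child with two parents returns as a parent, two time steps later. -/
lemma Explains.above_mem_parents (h : Explains G E r X) {y c : ℕ × V}
    (hc : c ∈ children G X y) (hc2 : 2 ≤ (parents G X c).card) : above c ∈ parents G X y := by
  obtain ⟨-, h1, h2⟩ := mem_children.1 hc
  refine mem_parents.2 ⟨h.above_mem hc2, ?_, h2.symm⟩
  simp only [above]
  omega

/-- The points that descend from `z` through points with exactly one parent. -/
inductive Skin (G : SimpleGraph V) (X : Finset (ℕ × V)) (z : ℕ × V) : ℕ × V → Prop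
  | base : Skin G X z z
  | step {u c : ℕ × V} : Skin G X z u → parents G X c = {u} → Skin G X z c

/-- Peeling: the skin below a point with at most one parent can be removed from an explanation,
provided that this parent is in `E` or keeps two other children. -/
lemma Explains.exists_ssubset (h : Explains G E r X) {z : ℕ × V} (hzX : z ∈ X) (hzr : z ≠ r)
    (hz : (parents G X z).card ≤ 1)
    (hy : ∀ y ∈ parents G X z, y ∈ E ∨ 3 ≤ (children G X y).card) :
    ∃ Y, Y ⊂ X ∧ Explains G E r Y := by
  classical
  have hskin : ∀ u, Skin G X z u → (parents G X u).card ≤ 1 := by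
    intro u hu
    cases hu with
    | base => exact hz
    | step _ h1 => simp [h1]
  have hr : ¬ Skin G X z r := by
    intro hs
    cases hs with
    | base => exact hzr rfl
    | step _ h1 => simp [h.parents_root] at h1
  set Y : Finset (ℕ × V) := {u ∈ X | ¬ Skin G X z u} with hYdef
  have hYX : Y ⊆ X := Finset.filter_subset _ _
  have hmemY : ∀ u, u ∈ Y ↔ u ∈ X ∧ ¬ Skin G X z u := fun u => by simp [hYdef]
  have hsub : ∀ u, children G Y u ⊆ children G X u := fun u c hc => by
    rw [mem_children] at hc ⊢
    exact ⟨hYX hc.1, hc.2⟩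
  refine ⟨Y, ?_, ?_⟩
  · refine (Finset.ssubset_iff_of_subset hYX).2 ⟨z, hzX, fun hzY => ?_⟩
    exact ((hmemY z).1 hzY).2 .base
  refine ⟨(hmemY r).2 ⟨h.root_mem, hr⟩, fun u hu => h.level_le u (hYX hu), ?_, ?_⟩
  · intro u hu
    obtain ⟨huX, hus⟩ := (hmemY u).1 hu
    -- the only child that `u` can lose is `z`
    have hlost : (children G X u).erase z ⊆ children G Y u := by
      intro c hc
      obtain ⟨hcz, hc⟩ := Finset.mem_erase.1 hc
      have hcX := (mem_children.1 hc).1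
      refine mem_children.2 ⟨(hmemY c).2 ⟨hcX, fun hcs => ?_⟩, (mem_children.1 hc).2⟩
      cases hcs with
      | base => exact hcz rfl
      | step hw h1 =>
        have := mem_parents_of_mem_children huX hc
        rw [h1, Finset.mem_singleton] at this
        exact hus (this ▸ hw)
    by_cases huz : u ∈ parents G X z
    · refine (hy u huz).imp_right fun h3 => ?_
      have := Finset.card_le_card hlost
      have := Finset.pred_card_le_card_erase (s := children G X u) (a := z)
      omega
    · refine (h.support u huX).imp_right fun h2 => h2.trans (Finset.card_le_card ?_)
      rwa [Finset.erase_eq_of_notMem] at hlost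
      exact fun hzu => huz (mem_parents_of_mem_children huX hzu)
  · intro a ha
    have haX : a ∈ X := h.fill a (ha.trans (Finset.card_le_card (hsub a)))
    refine (hmemY a).2 ⟨haX, fun has => ?_⟩
    -- children of a skin point that survive have a second parent, hence recur above as parents
    have himg : (children G Y a).image above ⊆ parents G X a := by
      intro w hw
      obtain ⟨c, hc, rfl⟩ := Finset.mem_image.1 hw
      refine h.above_mem_parents (hsub a hc) ?_
      by_contra! hlt
      have hap := mem_parents_of_mem_children haX (hsub a hc)
      have h1 : parents G X c = {a} :=
        (Finset.eq_of_subset_of_card_le (Finset.singleton_subset_iff.2 hap)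
          (by rw [Finset.card_singleton]; omega)).symm
      exact ((hmemY c).1 (mem_children.1 hc).1).2 (.step has h1)
    have := Finset.card_le_card himg
    rw [Finset.card_image_of_injective _ above_injective] at this
    have := hskin a has
    omega

/-! ### Minimal explanations -/

/-- The properties of a minimal explanation that make it a surface: no point has more than two
children or more than two parents. -/
structure Tight (G : SimpleGraph V) (E : Set (ℕ × V)) (r : ℕ × V) (X : Finset (ℕ × V)) : Prop
    extends Explains G E r X where
  parents_nonempty : ∀ z ∈ X, z ≠ r → (parents G X z).Nonempty
  card_children_le : ∀ z, (children G X z).card ≤ 2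

lemma Explains.exists_tight (h : Explains G E r X) : ∃ Y, Tight G E r Y := by
  classical
  obtain ⟨Y, hY, hmin⟩ : ∃ Y, Explains G E r Y ∧ ∀ Z, Z ⊂ Y → ¬ Explains G E r Z := by
    obtain ⟨Y, hY, hm⟩ := WellFounded.has_min (r := fun A B : Finset (ℕ × V) => A ⊂ B)
      Finset.isWellFounded_ssubset.wf {Y | Explains G E r Y} ⟨X, h⟩
    exact ⟨Y, hY, fun Z hZ hE => hm Z hE hZ⟩
  have hne : ∀ z ∈ Y, z ≠ r → (parents G Y z).card ≤ 1 →
      ∃ y ∈ parents G Y z, (children G Y y).card ≤ 2 := by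
    intro z hz hzr h1
    by_contra! hcon
    obtain ⟨Z, hZ, hE⟩ := hY.exists_ssubset hz hzr h1 fun y hy => .inr (hcon y hy)
    exact hmin Z hZ hE
  refine ⟨Y, hY, fun z hz hzr => ?_, ?_⟩
  · by_contra hcon
    rw [Finset.not_nonempty_iff_eq_empty] at hcon
    obtain ⟨y, hy, -⟩ := hne z hz hzr (by simp [hcon])
    simp [hcon] at hy
  -- A point with three children has only children with two parents, hence three parents, hence
  -- the point above it has three children again; this cannot go on for ever.
  have key : ∀ k : ℕ, ∀ z : ℕ × V, r.1 < z.1 + k → (children G Y z).card ≤ 2 := by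
    intro k
    induction k with
    | zero =>
      intro z hz
      by_contra! h3
      have := hY.level_le z (hY.fill z (by omega))
      omega
    | succ k ih =>
      intro z hz
      by_contra! h3
      have hzY : z ∈ Y := hY.fill z (by omega)
      have himg : (children G Y z).image above ⊆ parents G Y z := by
        intro w hw
        obtain ⟨c, hc, rfl⟩ := Finset.mem_image.1 hw
        refine hY.above_mem_parents hc ?_
        by_contra! hlt
        have hzc := mem_parents_of_mem_children hzY hc
        have hcr : c ≠ r := by
          rintro rfl
          simp [hY.parents_root] at hzc
        obtain ⟨y, hy, hy2⟩ := hne c (mem_children.1 hc).1 hcr (by omega)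
        have hyz : y = z := Finset.card_le_one.1 (by omega) _ hy _ hzc
        rw [hyz] at hy2
        omega
      have hle := Finset.card_le_card himg
      rw [Finset.card_image_of_injective _ above_injective, ← children_above] at hle
      have := ih (above z) (by simp only [above]; omega)
      omega
  exact fun z => key (r.1 + 1) z (by omega)

lemma Tight.card_parents_le (h : Tight G E r X) (z : ℕ × V) : (parents G X z).card ≤ 2 := by
  rw [← children_above]
  exact h.card_children_le _

open scoped Classical in
/-- The points with at most one parent. -/
noncomputable def tops (G : SimpleGraph V) (X : Finset (ℕ × V)) : Finset (ℕ × V) :=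
  {z ∈ X | (parents G X z).card ≤ 1}

open scoped Classical in
/-- The points that do not lie above a point with two parents. -/
noncomputable def bottoms (G : SimpleGraph V) (X : Finset (ℕ × V)) : Finset (ℕ × V) :=
  {z ∈ X | ∀ w ∈ X, 2 ≤ (parents G X w).card → above w ≠ z}

open scoped Classical in
/-- The points with fewer than two children. -/
noncomputable def leaves (G : SimpleGraph V) (X : Finset (ℕ × V)) : Finset (ℕ × V) :=
  {z ∈ X | (children G X z).card ≤ 1}

lemma mem_tops {z : ℕ × V} : z ∈ tops G X ↔ z ∈ X ∧ (parents G X z).card ≤ 1 := by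
  simp [tops]

lemma mem_bottoms {z : ℕ × V} :
    z ∈ bottoms G X ↔ z ∈ X ∧ ∀ w ∈ X, 2 ≤ (parents G X w).card → above w ≠ z := by
  simp [bottoms]

lemma mem_leaves {z : ℕ × V} : z ∈ leaves G X ↔ z ∈ X ∧ (children G X z).card ≤ 1 := by
  simp [leaves]

lemma Explains.mem_of_mem_leaves (h : Explains G E r X) {z : ℕ × V} (hz : z ∈ leaves G X) :
    z ∈ E := by
  rw [mem_leaves] at hz
  exact (h.support z hz.1).resolve_right (by omega)

lemma Explains.card_bottoms (h : Explains G E r X) : (bottoms G X).card = (tops G X).card := by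
  classical
  have h1 : bottoms G X = X \ (X \ tops G X).image above := by
    ext z
    simp only [mem_bottoms, Finset.mem_sdiff, Finset.mem_image, mem_tops, not_exists, not_and,
      not_le]
    refine and_congr_right fun _ => forall_congr' fun w => ?_
    constructor
    · exact fun hw h2 => hw h2.1 (h2.2 h2.1)
    · exact fun hw hwX h2 => hw ⟨hwX, fun _ => h2⟩
  have h2 : (X \ tops G X).image above ⊆ X := by
    intro z hz
    obtain ⟨w, hw, rfl⟩ := Finset.mem_image.1 hz
    rw [Finset.mem_sdiff, mem_tops] at hw
    refine h.above_mem ?_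
    by_contra! hlt
    exact hw.2 ⟨hw.1, by omega⟩
  have h3 : tops G X ⊆ X := Finset.filter_subset _ _
  rw [h1, Finset.card_sdiff_of_subset h2, Finset.card_image_of_injective _ above_injective,
    Finset.card_sdiff_of_subset h3]
  have := Finset.card_le_card h3
  omega

/-- Counting the pairs of a parent and a child in two ways. -/
lemma Tight.card_tops_le (h : Tight G E r X) : (tops G X).card ≤ 2 * (leaves G X).card := by
  classical
  have hdc : ∑ z ∈ X, (children G X z).card = ∑ z ∈ X, (parents G X z).card := by
    have := Finset.sum_card_bipartiteAbove_eq_sum_card_bipartiteBelow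
      (fun z w : ℕ × V => z.1 = w.1 + 1 ∧ G.Adj z.2 w.2) (s := X) (t := X)
    convert this using 3 <;> ext <;>
      simp [mem_children, mem_parents, Finset.mem_bipartiteAbove, Finset.mem_bipartiteBelow]
  have hlow : 2 * X.card ≤ ∑ z ∈ X, (children G X z).card + 2 * (leaves G X).card := by
    have : ∑ z ∈ X, 2 ≤ ∑ z ∈ X, ((children G X z).card +
        if (children G X z).card ≤ 1 then 2 else 0) :=
      Finset.sum_le_sum fun z _ => by split_ifs <;> omega
    rw [Finset.sum_add_distrib, ← Finset.sum_filter, Finset.sum_const, Finset.sum_const] at this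
    simp only [smul_eq_mul] at this
    have hr : (X.filter fun z => (children G X z).card ≤ 1) = leaves G X := by
      ext; simp [mem_leaves]
    rw [hr] at this
    omega
  have hup : ∑ z ∈ X, (parents G X z).card + (tops G X).card ≤ 2 * X.card := by
    have : ∑ z ∈ X, ((parents G X z).card + if (parents G X z).card ≤ 1 then 1 else 0) ≤
        ∑ z ∈ X, 2 :=
      Finset.sum_le_sum fun z _ => by
        have := h.card_parents_le z
        split_ifs <;> omega
    rw [Finset.sum_add_distrib, ← Finset.sum_filter, Finset.sum_const, Finset.sum_const] at this
    simp only [smul_eq_mul] at this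
    have hr : (X.filter fun z => (parents G X z).card ≤ 1) = tops G X := by
      ext; simp [mem_tops]
    rw [hr] at this
    omega
  omega

end Explanation

/-! ### Connectedness of the boundary -/

section Boundary

variable {V : Type*} {G : SimpleGraph V} {E : Set (ℕ × V)} {r : ℕ × V} {X : Finset (ℕ × V)}

/-- The pairs of a parent `y` and a child `c` that border at most one diamond of `X`, where a
diamond consists of a point with two parents, these parents and the point above: either there is no
diamond with lower side `y`, `c`, as `c` has only one parent, or none with upper side `y`, `c`, as
`y` does not lie above a point with two parents. -/
def BoundaryEdge (G : SimpleGraph V) (X : Finset (ℕ × V)) (y c : ℕ × V) : Prop :=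
  y ∈ X ∧ c ∈ children G X y ∧ ((parents G X c).card ≤ 1 ∨ y ∈ bottoms G X)

/-- For a labelling `χ` of space-time, the label that the pair of the parent `(n + 1, x)` and the
child `(n, b)` inherits from below: in the column over the edge `x b`, go down through the diamonds
to the lowest pair, and take the label of its parent. At `n = 0` there is no diamond below. -/
def columnLabel (G : SimpleGraph V) (X : Finset (ℕ × V)) (χ : ℕ × V → Prop) : ℕ → V → V → Prop
  | 0, x, _ => χ (1, x)
  | n + 1, x, b => ((n + 2, x) ∈ bottoms G X ∧ χ (n + 2, x)) ∨
      ((n + 2, x) ∉ bottoms G X ∧ columnLabel G X χ n b x)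

lemma columnLabel_of_mem_bottoms {χ : ℕ × V → Prop} {n : ℕ} {x b : V}
    (h : (n + 1, x) ∈ bottoms G X) : columnLabel G X χ n x b ↔ χ (n + 1, x) := by
  cases n with
  | zero => rfl
  | succ n => simp [columnLabel, h]

lemma columnLabel_of_notMem_bottoms {χ : ℕ × V → Prop} {n : ℕ} {x b : V}
    (h : (n + 2, x) ∉ bottoms G X) :
    columnLabel G X χ (n + 1) x b ↔ columnLabel G X χ n b x := by
  simp [columnLabel, h]

lemma exists_above_eq {n : ℕ} {x : V} (hX : (n, x) ∈ X) (h : (n, x) ∉ bottoms G X) :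
    ∃ m, n = m + 2 ∧ (m, x) ∈ X ∧ 2 ≤ (parents G X (m, x)).card := by
  rw [mem_bottoms] at h
  push Not at h
  obtain ⟨⟨m, y⟩, hw, h2, h3⟩ := h hX
  simp only [above, Prod.mk.injEq] at h3
  obtain ⟨rfl, rfl⟩ := h3
  exact ⟨m, rfl, hw, h2⟩

/-- If the labelling is constant along boundary edges, then all pairs at a given point inherit the
same label, which is the label of the point if the point is a top or a bottom. This goes by
induction on the time. Either the point is the upper end of a boundary edge, and then all its pairs
inherit its own label, or its children recur as its parents two time steps later, and the diamonds
with these sides carry the label from the pairs below to the pairs above. -/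
lemma Tight.exists_label (h : Tight G E r X) {χ : ℕ × V → Prop}
    (hχ : ∀ y c, BoundaryEdge G X y c → (χ y ↔ χ c)) (n : ℕ) :
    ∀ b, (n, b) ∈ X → ∃ L : Prop,
      (∀ x, (n + 1, x) ∈ parents G X (n, b) → (columnLabel G X χ n x b ↔ L)) ∧
      (∀ m c, n = m + 1 → (m, c) ∈ children G X (n, b) → (columnLabel G X χ m b c ↔ L)) ∧
      ((n, b) ∈ tops G X ∨ (n, b) ∈ bottoms G X → (L ↔ χ (n, b))) := by
  classical
  induction n using Nat.strong_induction_on with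
  | _ n ih =>
  intro b hb
  have hup : ∀ x, (n + 1, x) ∈ parents G X (n, b) → (n + 1, x) ∈ bottoms G X →
      (columnLabel G X χ n x b ↔ χ (n, b)) := fun x hx hxb =>
    (columnLabel_of_mem_bottoms hxb).trans
      (hχ _ _ ⟨(mem_parents.1 hx).1, mem_children_of_mem_parents hb hx, .inr hxb⟩)
  obtain _ | n := n
  · refine ⟨χ (0, b), fun x hx => hup x hx ?_, fun m c hm => by omega, fun _ => Iff.rfl⟩
    by_contra hcon
    obtain ⟨m, hm, -⟩ := exists_above_eq (mem_parents.1 hx).1 hcon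
    omega
  have hdown : ∀ c c', (n, c) ∈ children G X (n + 1, b) → (n, c') ∈ children G X (n + 1, b) →
      (columnLabel G X χ n b c ↔ columnLabel G X χ n b c') := by
    intro c c' hc hc'
    by_cases hbb : (n + 1, b) ∈ bottoms G X
    · rw [columnLabel_of_mem_bottoms hbb, columnLabel_of_mem_bottoms hbb]
    · obtain ⟨m, hm, hmX, -⟩ := exists_above_eq hb hbb
      obtain rfl : n = m + 1 := by omega
      rw [columnLabel_of_notMem_bottoms hbb, columnLabel_of_notMem_bottoms hbb]
      obtain ⟨L, hL, -⟩ := ih m (by omega) b hmX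
      have hpar : ∀ c, (m + 1, c) ∈ children G X (m + 1 + 1, b) →
          (m + 1, c) ∈ parents G X (m, b) := fun c hc => by
        rw [← children_above]; exact hc
      exact (hL c (hpar c hc)).trans (hL c' (hpar c' hc')).symm
  by_cases hA : (n + 1, b) ∈ bottoms G X ∨
      ∃ c, (n, c) ∈ children G X (n + 1, b) ∧ (parents G X (n, c)).card ≤ 1
  · have hd : ∀ c, (n, c) ∈ children G X (n + 1, b) →
        (columnLabel G X χ n b c ↔ χ (n + 1, b)) := by
      intro c hc
      rcases hA with hA | ⟨c', hc', h1⟩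
      · exact columnLabel_of_mem_bottoms hA
      · refine (hdown c c' hc hc').trans ?_
        have hcX := (mem_children.1 hc').1
        obtain ⟨L, hL, -, hLχ⟩ := ih n (by omega) c' hcX
        exact (hL b (mem_parents_of_mem_children hb hc')).trans <|
          (hLχ (.inl (mem_tops.2 ⟨hcX, h1⟩))).trans (hχ _ _ ⟨hb, hc', .inl h1⟩).symm
    refine ⟨χ (n + 1, b), fun x hx => ?_, ?_, fun _ => Iff.rfl⟩
    · by_cases hxb : (n + 1 + 1, x) ∈ bottoms G X
      · exact hup x hx hxb
      · obtain ⟨m, hm, hmX, -⟩ := exists_above_eq (mem_parents.1 hx).1 hxb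
        obtain rfl : n = m := by omega
        exact (columnLabel_of_notMem_bottoms hxb).trans
          (hd x (mem_children.2 ⟨hmX, rfl, (mem_parents.1 hx).2.2.symm⟩))
    · intro m c hm hc
      obtain rfl : n = m := by omega
      exact hd c hc
  · -- here the children, moved up by two time steps, are exactly the parents
    push Not at hA
    obtain ⟨hbb, hQ⟩ := hA
    obtain ⟨m, hm, -, hm2⟩ := exists_above_eq hb hbb
    have hq : 2 ≤ (children G X (n + 1, b)).card := by
      have : (n + 1, b) = above (m, b) := by simp [above, hm]
      rwa [this, children_above]
    have hlev : ∀ c ∈ children G X (n + 1, b), c = (n, c.2) := fun c hc => by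
      have := (mem_children.1 hc).2.1
      refine Prod.ext ?_ rfl
      simp only at this ⊢
      omega
    have hQ' : ∀ c ∈ children G X (n + 1, b), 2 ≤ (parents G X c).card := fun c hc => by
      have hc' := hlev c hc
      rw [hc'] at hc ⊢
      exact hQ c.2 hc
    have himg : (children G X (n + 1, b)).image above = parents G X (n + 1, b) := by
      refine Finset.eq_of_subset_of_card_le (fun w hw => ?_) ?_
      · obtain ⟨c, hc, rfl⟩ := Finset.mem_image.1 hw
        exact h.above_mem_parents hc (hQ' c hc)
      · rw [Finset.card_image_of_injective _ above_injective]
        exact (h.card_parents_le _).trans hq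
    obtain ⟨c₀, hc₀⟩ : (children G X (n + 1, b)).Nonempty := Finset.card_pos.1 (by omega)
    have hc₀' := hc₀
    rw [hlev c₀ hc₀] at hc₀'
    refine ⟨columnLabel G X χ n b c₀.2, fun x hx => ?_, ?_, fun hor => ?_⟩
    · rw [← himg] at hx
      obtain ⟨c, hc, hcx⟩ := Finset.mem_image.1 hx
      have hcX := (mem_children.1 hc).1
      have hxb : (n + 2, x) ∉ bottoms G X := fun hxb =>
        (mem_bottoms.1 hxb).2 c hcX (hQ' c hc) hcx
      have hce : c = (n, x) := by
        rw [hlev c hc] at hcx ⊢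
        simpa [above] using hcx
      exact (columnLabel_of_notMem_bottoms hxb).trans (hdown _ _ (hce ▸ hc) hc₀')
    · intro m c hm hc
      obtain rfl : n = m := by omega
      exact hdown _ _ hc hc₀'
    · rcases hor with hor | hor
      · have := (mem_tops.1 hor).2
        rw [← himg, Finset.card_image_of_injective _ above_injective] at this
        omega
      · exact absurd hor hbb

/-- A labelling that is constant along boundary edges is constant on the boundary. -/
lemma Tight.label_iff (h : Tight G E r X) {χ : ℕ × V → Prop}
    (hχ : ∀ y c, BoundaryEdge G X y c → (χ y ↔ χ c)) {z : ℕ × V}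
    (hz : z ∈ tops G X ∨ z ∈ bottoms G X) : χ z ↔ χ r := by
  have hrt : r ∈ tops G X := mem_tops.2 ⟨h.root_mem, by simp [h.parents_root]⟩
  -- every pair inherits the label of `r`, by induction from the latest time down
  have key : ∀ k n x b, r.1 ≤ n + k → (n, b) ∈ X → (n + 1, x) ∈ parents G X (n, b) →
      (columnLabel G X χ n x b ↔ χ r) := by
    intro k
    induction k with
    | zero =>
      intro n x b hk _ hx
      have := h.level_le _ (mem_parents.1 hx).1
      simp only at this
      omega
    | succ k ih =>
      intro n x b hk hb hx
      have hxX := (mem_parents.1 hx).1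
      obtain ⟨L, hL, hL', hLχ⟩ := h.exists_label hχ (n + 1) x hxX
      refine (hL' n b rfl (mem_children_of_mem_parents hb hx)).trans ?_
      by_cases hxr : (n + 1, x) = r
      · rw [← hxr] at hrt ⊢
        exact hLχ (.inl hrt)
      · obtain ⟨⟨m, y⟩, hy⟩ := h.parents_nonempty _ hxX hxr
        obtain rfl : m = n + 1 + 1 := (mem_parents.1 hy).2.1
        exact (hL y hy).symm.trans (ih (n + 1) y x (by omega) hxX hy)
  have hzX : z ∈ X := hz.elim (fun h => (mem_tops.1 h).1) (fun h => (mem_bottoms.1 h).1)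
  by_cases hzr : z = r
  · rw [hzr]
  obtain ⟨n, b⟩ := z
  obtain ⟨⟨m, y⟩, hy⟩ := h.parents_nonempty _ hzX hzr
  obtain rfl : m = n + 1 := (mem_parents.1 hy).2.1
  obtain ⟨L, hL, -, hLχ⟩ := h.exists_label hχ n b hzX
  exact (hLχ hz).symm.trans <| (hL y hy).symm.trans (key r.1 n y b (by omega) hzX hy)

lemma leaves_subset_bottoms : leaves G X ⊆ bottoms G X := by
  intro z hz
  rw [mem_leaves] at hz
  refine mem_bottoms.2 ⟨hz.1, fun w _ h2 hw => ?_⟩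
  rw [← hw, children_above] at hz
  omega

open scoped Classical in
/-- A set containing the endpoints of all boundary edges. -/
noncomputable def boundaryPoints (G : SimpleGraph V) (X : Finset (ℕ × V)) : Finset (ℕ × V) :=
  (tops G X ∪ (tops G X).biUnion (parents G X)) ∪
    (bottoms G X ∪ (bottoms G X).biUnion (children G X))

lemma BoundaryEdge.mem_boundaryPoints {y c : ℕ × V} (h : BoundaryEdge G X y c) :
    y ∈ boundaryPoints G X ∧ c ∈ boundaryPoints G X := by
  obtain ⟨hy, hc, h1 | hb⟩ := h
  · have ht : c ∈ tops G X := mem_tops.2 ⟨(mem_children.1 hc).1, h1⟩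
    have hyc := mem_parents_of_mem_children hy hc
    simp only [boundaryPoints, Finset.mem_union, Finset.mem_biUnion]
    exact ⟨.inl (.inr ⟨c, ht, hyc⟩), .inl (.inl ht)⟩
  · simp only [boundaryPoints, Finset.mem_union, Finset.mem_biUnion]
    exact ⟨.inr (.inl hb), .inr (.inr ⟨y, hb, hc⟩)⟩

/-- The boundary is at most a constant times larger than the set of leaves. -/
lemma Tight.card_boundaryPoints_le (h : Tight G E r X) :
    (boundaryPoints G X).card ≤ 10 * (leaves G X).card := by
  classical
  have h1 := h.card_tops_le
  have h2 := h.card_bottoms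
  have h3 : ((tops G X).biUnion (parents G X)).card ≤ (tops G X).card * 1 :=
    Finset.card_biUnion_le_card_mul _ _ _ fun z hz => (mem_tops.1 hz).2
  have h4 : ((bottoms G X).biUnion (children G X)).card ≤ (bottoms G X).card * 2 :=
    Finset.card_biUnion_le_card_mul _ _ _ fun z _ => h.card_children_le z
  have h5 := Finset.card_union_le (tops G X ∪ (tops G X).biUnion (parents G X))
    (bottoms G X ∪ (bottoms G X).biUnion (children G X))
  have h6 := Finset.card_union_le (tops G X) ((tops G X).biUnion (parents G X))
  have h7 := Finset.card_union_le (bottoms G X) ((bottoms G X).biUnion (children G X))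
  rw [boundaryPoints]
  omega

/-- All leaves can be reached from `r` along boundary edges. -/
lemma Tight.reflTransGen_of_mem_leaves (h : Tight G E r X) {z : ℕ × V} (hz : z ∈ leaves G X) :
    Relation.ReflTransGen (fun y c => BoundaryEdge G X y c ∨ BoundaryEdge G X c y) r z := by
  refine (h.label_iff (χ := Relation.ReflTransGen _ r) (fun y c hyc => ?_)
    (.inr (leaves_subset_bottoms hz))).2 .refl
  exact ⟨fun hy => hy.tail (.inl hyc), fun hc => hc.tail (.inr hyc)⟩

end Boundary

/-! ### Walks that cover a connected set -/

section Walk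

variable {α ι : Type*} (step : α → ι → α)

open scoped Classical in
/-- The points visited by the walk that starts at `a` and makes the moves in `l`. -/
noncomputable def visited (a : α) (l : List ι) : Finset α :=
  (l.inits.map (List.foldl step a)).toFinset

variable {step}

lemma mem_visited {a z : α} {l : List ι} :
    z ∈ visited step a l ↔ ∃ l₁ l₂, l = l₁ ++ l₂ ∧ l₁.foldl step a = z := by
  simp only [visited, List.mem_toFinset, List.mem_map, List.mem_inits]
  constructor
  · rintro ⟨l₁, ⟨l₂, h⟩, hz⟩
    exact ⟨l₁, l₂, h.symm, hz⟩
  · rintro ⟨l₁, l₂, h, hz⟩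
    exact ⟨l₁, ⟨l₂, h.symm⟩, hz⟩

lemma card_visited_le (a : α) (l : List ι) : (visited step a l).card ≤ l.length + 1 := by
  classical
  refine (List.toFinset_card_le _).trans ?_
  simp

/-- A detour to a neighbor can be inserted into a walk. -/
lemma exists_insert_visited {a b c : α} {l : List ι} (hb : b ∈ visited step a l) {i j : ι}
    (hi : step b i = c) (hj : step c j = b) :
    ∃ l', l'.length = l.length + 2 ∧ c ∈ visited step a l' ∧
      visited step a l ⊆ visited step a l' := by
  obtain ⟨l₁, l₂, rfl, hl₁⟩ := mem_visited.1 hb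
  have hfold : (l₁ ++ [i, j]).foldl step a = b := by simp [hl₁, hi, hj]
  refine ⟨l₁ ++ [i, j] ++ l₂, by simp; omega,
    mem_visited.2 ⟨l₁ ++ [i], j :: l₂, by simp, by simp [hl₁, hi]⟩, fun z hz => ?_⟩
  obtain ⟨m₁, m₂, hm, hmz⟩ := mem_visited.1 hz
  rw [mem_visited]
  rcases List.append_eq_append_iff.1 hm with ⟨k, rfl, rfl⟩ | ⟨k, rfl, rfl⟩
  · refine ⟨l₁ ++ [i, j] ++ k, m₂, by simp, ?_⟩
    rw [List.foldl_append, hfold, ← hl₁, ← List.foldl_append, hmz]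
  · exact ⟨m₁, k ++ [i, j] ++ l₂, by simp, hmz⟩

/-- Points that can be reached from `a` inside a set of `k` points are visited by a single walk
with `2 * k` moves. -/
lemma exists_visited {S : α → α → Prop} (hS : ∀ x y, S x y → ∃ i j, step x i = y ∧ step y j = x)
    (hstay : ∀ x, ∃ i, step x i = x) {a : α} {Z F : Finset α} (hZ : ∀ x y, S x y → y ∈ Z)
    (hF : ∀ z ∈ F, Relation.ReflTransGen S a z) {k : ℕ} (hk : Z.card ≤ k) :
    ∃ l : List ι, l.length = 2 * k ∧ F ⊆ visited step a l := by
  classical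
  have key : ∀ n : ℕ, ∃ l : List ι, l.length = 2 * n ∧ a ∈ visited step a l ∧
      (F ⊆ visited step a l ∨ n ≤ (Z ∩ visited step a l).card) := by
    intro n
    induction n with
    | zero => exact ⟨[], rfl, mem_visited.2 ⟨[], [], rfl, rfl⟩, .inr (Nat.zero_le _)⟩
    | succ n ih =>
      obtain ⟨l, hl, ha, hor⟩ := ih
      by_cases hFl : F ⊆ visited step a l
      · obtain ⟨i, hi⟩ := hstay a
        obtain ⟨l', hl', -, hsub⟩ := exists_insert_visited ha hi hi
        exact ⟨l', by omega, hsub ha, .inl (hFl.trans hsub)⟩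
      · have hn := hor.resolve_left hFl
        obtain ⟨z, hzF, hz⟩ := Finset.not_subset.1 hFl
        obtain ⟨x, y, hxy, hx, hy⟩ : ∃ x y, S x y ∧ x ∈ visited step a l ∧
            y ∉ visited step a l := by
          by_contra! hcon
          have : ∀ w, Relation.ReflTransGen S a w → w ∈ visited step a l := by
            intro w hw
            induction hw with
            | refl => exact ha
            | tail _ h1 ih => exact hcon _ _ h1 ih
          exact hz (this z (hF z hzF))
        obtain ⟨i, j, hi, hj⟩ := hS x y hxy
        obtain ⟨l', hl', hyl', hsub⟩ := exists_insert_visited hx hi hj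
        refine ⟨l', by omega, hsub ha, .inr ?_⟩
        have hlt : Z ∩ visited step a l ⊂ Z ∩ visited step a l' := by
          refine (Finset.ssubset_iff_of_subset (Finset.inter_subset_inter_left hsub)).2 ⟨y, ?_, ?_⟩
          · exact Finset.mem_inter.2 ⟨hZ x y hxy, hyl'⟩
          · exact fun h => hy (Finset.mem_inter.1 h).2
        have := Finset.card_lt_card hlt
        omega
  obtain ⟨l, hl, ha, hor⟩ := key k
  refine ⟨l, hl, hor.elim id fun hk' => ?_⟩
  have hZl : Z ⊆ visited step a l := by
    have := Finset.eq_of_subset_of_card_le (Finset.inter_subset_left (s₁ := Z)) (hk.trans hk')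
    exact Finset.inter_eq_left.1 this
  intro z hz
  rcases Relation.ReflTransGen.cases_tail (hF z hz) with rfl | ⟨w, -, hw⟩
  · exact ha
  · exact hZl (hZ w z hw)

end Walk

/-! ### Minus spins have explanations -/

section MinusSet

variable {V : Type*} {G : SimpleGraph V}

/-- The vertices that have spin `-1` at time `t` when noise spins `1` are ignored and the noise
spins `-1` are at the points of `E`. -/
def minusSet (G : SimpleGraph V) (E : Set (ℕ × V)) : ℕ → Set V
  | 0 => ∅
  | t + 1 => {x | (t + 1, x) ∈ E ∨
      ∃ y z, y ≠ z ∧ G.Adj x y ∧ G.Adj x z ∧ y ∈ minusSet G E t ∧ z ∈ minusSet G E t}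

lemma mem_minusSet_of_process_eq {ω : ℕ × V → Update} {t : ℕ} {x : V}
    (h : process G ω t x = -1) : x ∈ minusSet G {z | ω z = (true, -1)} t := by
  induction t generalizing x with
  | zero => simp [process] at h
  | succ t ih =>
    simp only [process] at h
    split_ifs at h with hn
    · exact .inl (Prod.ext hn h)
    · rw [biasUpdate] at h
      split_ifs at h with h2
      · have h1 : 1 < {y : V | G.Adj x y ∧ process G ω t y = -1}.encard :=
          lt_of_lt_of_le (by norm_num) h2
        obtain ⟨y, z, hy, hz, hyz⟩ := Set.one_lt_encard_iff.1 h1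
        exact .inr ⟨y, z, hyz, hy.1, hz.1, ih hy.2, ih hz.2⟩
      · exact absurd h (by decide)

lemma finite_setOf_walk_length_eq [G.LocallyFinite] (n : ℕ) :
    ∀ v, {x | ∃ p : G.Walk v x, p.length = n}.Finite := by
  induction n with
  | zero =>
    refine fun v => (Set.finite_singleton v).subset ?_
    rintro x ⟨p, hp⟩
    exact (SimpleGraph.Walk.eq_of_length_eq_zero hp).symm
  | succ n ih =>
    refine fun v => ((G.neighborSet v).toFinite.biUnion fun w _ => ih w).subset ?_
    rintro x ⟨p, hp⟩
    cases p with
    | nil => simp at hp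
    | cons hw p => exact Set.mem_biUnion hw ⟨p, by simpa using hp⟩

/-- In a tree, of two neighbors of `a` at least one is farther from `v` than `a`. -/
lemma dist_add_one_le_of_isTree (hG : G.IsTree) (v : V) {a b c : V} (hb : G.Adj a b)
    (hc : G.Adj a c) (hbc : b ≠ c) : G.dist v a + 1 ≤ max (G.dist v b) (G.dist v c) := by
  have hb' := hG.dist_eq_dist_add_one_of_adj v hb
  have hc' := hG.dist_eq_dist_add_one_of_adj v hc
  by_contra! hlt
  rw [max_lt_iff] at hlt
  obtain ⟨p, hp⟩ := hG.connected.exists_walk_length_eq_dist v b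
  obtain ⟨q, hq⟩ := hG.connected.exists_walk_length_eq_dist v c
  have hp' : (p.concat hb.symm).IsPath :=
    SimpleGraph.Walk.isPath_of_length_eq_dist _ (by rw [SimpleGraph.Walk.length_concat]; omega)
  have hq' : (q.concat hc.symm).IsPath :=
    SimpleGraph.Walk.isPath_of_length_eq_dist _ (by rw [SimpleGraph.Walk.length_concat]; omega)
  obtain ⟨h, -⟩ := SimpleGraph.Walk.concat_inj
    (congrArg Subtype.val ((hG.isAcyclic.subsingleton_path v a).elim ⟨_, hp'⟩ ⟨_, hq'⟩))
  exact hbc h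

/-- The part of the minus set in the backward light cone of a point is an explanation. That the
light cone is closed under `Explains.fill` is the only place where the tree structure matters. -/
lemma exists_explains [G.LocallyFinite] (hG : G.IsTree) {E : Set (ℕ × V)} {t : ℕ} {v : V}
    (h : v ∈ minusSet G E t) : ∃ X, Explains G E (t, v) X := by
  classical
  have hball : ∀ n, {x | G.dist v x = n}.Finite := fun n =>
    (finite_setOf_walk_length_eq n v).subset fun x hx => by
      obtain ⟨p, hp⟩ := hG.connected.exists_walk_length_eq_dist v x
      exact ⟨p, hp.trans hx⟩
  have hfin : {z : ℕ × V | z.2 ∈ minusSet G E z.1 ∧ G.dist v z.2 + z.1 ≤ t}.Finite := by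
    refine ((Set.finite_Iic t).prod
      ((Set.finite_Iic t).biUnion fun n _ => hball n)).subset ?_
    rintro ⟨s, x⟩ ⟨-, hx⟩
    simp only at hx
    refine ⟨?_, Set.mem_biUnion (x := G.dist v x) ?_ rfl⟩ <;> simp only [Set.mem_Iic] <;> omega
  have hmem : ∀ z, z ∈ hfin.toFinset ↔ z.2 ∈ minusSet G E z.1 ∧ G.dist v z.2 + z.1 ≤ t := by simp
  refine ⟨hfin.toFinset, (hmem _).2 ⟨h, by simp⟩, fun z hz => ?_, ?_, ?_⟩
  · have := ((hmem z).1 hz).2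
    simp only
    omega
  · rintro ⟨s, x⟩ hz
    obtain ⟨hx, hxt⟩ := (hmem _).1 hz
    simp only at hx hxt
    cases s with
    | zero => exact hx.elim
    | succ s =>
      refine hx.imp_right ?_
      rintro ⟨y, y', hyy, hy, hy', hym, hym'⟩
      have hchild : ∀ w, G.Adj x w → w ∈ minusSet G E s →
          (s, w) ∈ children G hfin.toFinset (s + 1, x) := fun w hw hwm => by
        refine mem_children.2 ⟨(hmem _).2 ⟨hwm, ?_⟩, rfl, hw⟩
        have := hG.dist_eq_dist_add_one_of_adj v hw
        simp only
        omega
      exact Finset.one_lt_card.2 ⟨_, hchild y hy hym, _, hchild y' hy' hym', by simpa using hyy⟩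
  · rintro ⟨s, x⟩ h2
    obtain ⟨⟨m, y⟩, hy, ⟨m', y'⟩, hy', hne⟩ := Finset.one_lt_card.1 h2
    obtain ⟨hyX, rfl, hxy⟩ := mem_children.1 hy
    obtain ⟨hyX', hm, hxy'⟩ := mem_children.1 hy'
    simp only [Nat.add_right_cancel_iff] at hm hxy hxy'
    subst hm
    have hyy : y ≠ y' := fun h => hne (by rw [h])
    obtain ⟨hym, hyt⟩ := (hmem _).1 hyX
    obtain ⟨hym', hyt'⟩ := (hmem _).1 hyX'
    refine (hmem _).2 ⟨.inr ⟨y, y', hyy, hxy, hxy', hym, hym'⟩, ?_⟩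
    have := dist_add_one_le_of_isTree hG v hxy hxy' hyy
    simp only at hyt hyt' ⊢
    rcases le_max_iff.1 this with h | h <;> omega

end MinusSet

/-! ### The union bound -/

section UnionBound

variable {V : Type*} {G : SimpleGraph V}

lemma updateLaw_minus_le (ε : unitInterval) :
    updateLaw ε {(true, -1)} ≤ ENNReal.ofReal (ε : ℝ) := by
  have hsub : ({(true, -1)} : Set Update) ⊆ {true} ×ˢ Set.univ := by
    rintro _ rfl
    simp
  refine (measure_mono hsub).trans ?_
  rw [updateLaw, Measure.prod_prod, measure_univ, mul_one,
    bernoulliMeasure_apply ε (measurableSet_singleton _)]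
  simp only [Set.mem_singleton_iff, ENNReal.ofReal, unitInterval.toNNReal,
    Real.toNNReal_of_nonneg ε.2.1]
  simp
  rfl

lemma processLaw_subset_le (ε : unitInterval) (A : Finset (ℕ × V)) :
    processLaw V ε {ω | ∀ z ∈ A, ω z = (true, -1)} ≤ ENNReal.ofReal (ε : ℝ) ^ A.card := by
  have hset : {ω : ℕ × V → Update | ∀ z ∈ A, ω z = (true, -1)} =
      (A : Set (ℕ × V)).pi fun _ => {(true, -1)} := by
    ext ω
    simp [Set.mem_pi]
  rw [hset, processLaw, Measure.infinitePi_pi _ fun _ _ => measurableSet_singleton _]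
  exact (Finset.prod_le_pow_card _ _ _ fun _ _ => updateLaw_minus_le ε)

/-- Moves in space-time: stay, or go to the `i`-th neighbor, one time step later or earlier. -/
def move {d : ℕ} (nbr : V → Fin d → V) (z : ℕ × V) : Option (Bool × Fin d) → ℕ × V
  | none => z
  | some (true, i) => (z.1 + 1, nbr z.2 i)
  | some (false, i) => (z.1 - 1, nbr z.2 i)

lemma exists_move {d : ℕ} {nbr : V → Fin d → V} (hnbr : ∀ x y, G.Adj x y → ∃ i, nbr x i = y)
    {X : Finset (ℕ × V)} {y c : ℕ × V} (h : BoundaryEdge G X y c) :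
    (∃ i, move nbr y i = c) ∧ ∃ i, move nbr c i = y := by
  obtain ⟨-, h1, h2⟩ := mem_children.1 h.2.1
  obtain ⟨i, hi⟩ := hnbr _ _ h2
  obtain ⟨j, hj⟩ := hnbr _ _ h2.symm
  refine ⟨⟨some (false, i), Prod.ext ?_ hi⟩, ⟨some (true, j), Prod.ext ?_ hj⟩⟩
  · simp [move, h1]
  · simp [move, h1]

/-- A minus spin entails a walk in space-time that meets points with noise spin `-1` at a positive
rate. -/
lemma exists_walk_of_process_eq [G.LocallyFinite] (hG : G.IsTree) {d : ℕ} {nbr : V → Fin d → V}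
    (hnbr : ∀ x y, G.Adj x y → ∃ i, nbr x i = y) {ω : ℕ × V → Update} {t : ℕ} {v : V}
    (h : process G ω t v = -1) :
    ∃ n : ℕ, ∃ l : List.Vector (Option (Bool × Fin d)) (20 * (n + 1)),
      ∃ A ∈ (visited (move nbr) (t, v) l.1).powersetCard (n + 1), ∀ z ∈ A, ω z = (true, -1) := by
  obtain ⟨X, hX⟩ := exists_explains hG (mem_minusSet_of_process_eq h)
  obtain ⟨Y, hY⟩ := hX.exists_tight
  have hpos : 0 < (leaves G Y).card := by
    have : 0 < (tops G Y).card :=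
      Finset.card_pos.2 ⟨_, mem_tops.2 ⟨hY.root_mem, by simp [hY.parents_root]⟩⟩
    have := hY.card_tops_le
    omega
  obtain ⟨n, hn⟩ : ∃ n, (leaves G Y).card = n + 1 := ⟨_, (Nat.succ_pred_eq_of_pos hpos).symm⟩
  obtain ⟨l, hl, hsub⟩ := exists_visited (step := move nbr)
    (S := fun y c => BoundaryEdge G Y y c ∨ BoundaryEdge G Y c y)
    (fun x y hxy => by
      rcases hxy with hxy | hxy
      · obtain ⟨⟨i, hi⟩, j, hj⟩ := exists_move hnbr hxy
        exact ⟨i, j, hi, hj⟩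
      · obtain ⟨⟨i, hi⟩, j, hj⟩ := exists_move hnbr hxy
        exact ⟨j, i, hj, hi⟩)
    (fun x => ⟨none, rfl⟩)
    (fun x y hxy => hxy.elim (fun h => h.mem_boundaryPoints.2) fun h => h.mem_boundaryPoints.1)
    (fun z hz => hY.reflTransGen_of_mem_leaves hz) hY.card_boundaryPoints_le
  refine ⟨n, ⟨l, by omega⟩, leaves G Y, Finset.mem_powersetCard.2 ⟨hsub, hn⟩, fun z hz => ?_⟩
  exact hY.mem_of_mem_leaves hz

lemma processLaw_process_eq_le [G.LocallyFinite] (hG : G.IsTree) {d : ℕ}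
    (hd : G.IsRegularOfDegree d) (ε : unitInterval) (t : ℕ) (v : V) :
    processLaw V ε {ω | process G ω t v = -1} ≤
      ∑' n : ℕ, 2 * ((2 * (2 * d + 1) : ENNReal) ^ 20 * ENNReal.ofReal (ε : ℝ)) ^ (n + 1) := by
  classical
  let nbr : V → Fin d → V := fun x i => ((G.neighborFinset x).equivFinOfCardEq (hd x)).symm i
  have hnbr : ∀ x y, G.Adj x y → ∃ i, nbr x i = y := fun x y hxy =>
    ⟨(G.neighborFinset x).equivFinOfCardEq (hd x) ⟨y, by simpa using hxy⟩, by simp [nbr]⟩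
  have hsub : {ω | process G ω t v = -1} ⊆
      ⋃ n : ℕ, ⋃ l : List.Vector (Option (Bool × Fin d)) (20 * (n + 1)),
        ⋃ A ∈ (visited (move nbr) (t, v) l.1).powersetCard (n + 1),
          {ω | ∀ z ∈ A, ω z = (true, -1)} := by
    intro ω hω
    simpa only [Set.mem_iUnion, exists_prop, Set.mem_ofPred_eq] using
      exists_walk_of_process_eq hG hnbr hω
  refine (measure_mono hsub).trans <| (measure_iUnion_le _).trans <|
    ENNReal.tsum_le_tsum fun n => ?_
  set δ := ENNReal.ofReal (ε : ℝ)
  have hl : ∀ l : List.Vector (Option (Bool × Fin d)) (20 * (n + 1)),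
      processLaw V ε (⋃ A ∈ (visited (move nbr) (t, v) l.1).powersetCard (n + 1),
        {ω | ∀ z ∈ A, ω z = (true, -1)}) ≤ 2 ^ (20 * (n + 1) + 1) * δ ^ (n + 1) := by
    intro l
    refine (measure_biUnion_finset_le _ _).trans ?_
    refine (Finset.sum_le_card_nsmul _ _ (δ ^ (n + 1)) fun A hA => ?_).trans ?_
    · have := processLaw_subset_le ε A
      rwa [(Finset.mem_powersetCard.1 hA).2] at this
    · rw [nsmul_eq_mul]
      gcongr
      have h1 : ((visited (move nbr) (t, v) l.1).powersetCard (n + 1)).card ≤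
          2 ^ (20 * (n + 1) + 1) := by
        rw [Finset.card_powersetCard]
        refine (Nat.choose_le_two_pow _ _).trans (Nat.pow_le_pow_right (by norm_num) ?_)
        have := card_visited_le (step := move nbr) (t, v) l.1
        rwa [l.2] at this
      exact_mod_cast h1
  refine (measure_iUnion_le _).trans ?_
  rw [tsum_fintype]
  refine (Finset.sum_le_card_nsmul _ _ _ fun l _ => hl l).trans (le_of_eq ?_)
  rw [Finset.card_univ, card_vector, nsmul_eq_mul]
  simp only [Fintype.card_option, Fintype.card_prod, Fintype.card_bool, Fintype.card_fin]
  push_cast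
  rw [mul_pow, mul_pow, mul_pow, ← pow_mul, ← pow_mul, pow_succ 2]
  ring

lemma tsum_two_mul_pow_le {q : ENNReal} (hq : q ≤ 16⁻¹) :
    ∑' n : ℕ, 2 * q ^ (n + 1) ≤ 4⁻¹ := by
  have h1 : (1 - q)⁻¹ ≤ 2 := by
    rw [ENNReal.inv_le_iff_inv_le]
    refine ENNReal.le_sub_of_add_le_right (ne_top_of_le_ne_top (by simp) hq) ?_
    calc (2 : ENNReal)⁻¹ + q ≤ 2⁻¹ + 2⁻¹ := by
          gcongr
          exact hq.trans (ENNReal.inv_le_inv.2 (by norm_num))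
      _ = 1 := ENNReal.inv_two_add_inv_two
  rw [ENNReal.tsum_mul_left, ENNReal.tsum_geometric_add_one]
  calc 2 * (q * (1 - q)⁻¹) ≤ 2 * (16⁻¹ * 2) := by gcongr
    _ = 4 * (4 * 4)⁻¹ := by norm_num; ring
    _ = 4⁻¹ := by
      rw [ENNReal.mul_inv (by simp) (by simp), ← mul_assoc,
        ENNReal.mul_inv_cancel (by simp) (by simp), one_mul]

end UnionBound

end MinusBiasedVote

theorem theorem1p2 (d : ℕ) (hd : 3 ≤ d) :
    ∃ c : ℝ, 0 < c ∧ c < 1 / 2 ∧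
      ∃ ε₀ : ℝ, 0 < ε₀ ∧ ε₀ < 1 ∧
        ∀ (V : Type*) (G : SimpleGraph V) [G.LocallyFinite],
          G.IsTree → G.IsRegularOfDegree d →
            ∀ ε : unitInterval, 0 < (ε : ℝ) → (ε : ℝ) < ε₀ →
              ∀ (v : V) (t : ℕ),
                (MinusBiasedVote.processLaw V ε).real
                  {ω | MinusBiasedVote.process G ω t v = -1} ≤ c := by
  have hK : (1 : ℝ) ≤ (2 * (2 * d + 1)) ^ 20 :=
    one_le_pow₀ (by linarith [Nat.cast_nonneg (α := ℝ) d])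
  refine ⟨1 / 4, by norm_num, by norm_num, 1 / (16 * (2 * (2 * d + 1)) ^ 20), by positivity, ?_, ?_⟩
  · rw [div_lt_one (by positivity)]
    linarith
  intro V G _ hG hreg ε _ hε v t
  rw [lt_div_iff₀ (by positivity)] at hε
  refine ENNReal.toReal_le_of_le_ofReal (by norm_num) ?_
  refine (MinusBiasedVote.processLaw_process_eq_le hG hreg ε t v).trans ?_
  refine (MinusBiasedVote.tsum_two_mul_pow_le ?_).trans (le_of_eq ?_)
  · have h1 : (2 * (2 * d + 1) : ENNReal) ^ 20 * ENNReal.ofReal (ε : ℝ) =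
        ENNReal.ofReal ((2 * (2 * d + 1)) ^ 20 * ε) := by
      rw [ENNReal.ofReal_mul (by positivity), ENNReal.ofReal_pow (by positivity)]
      congr 2
      rw [ENNReal.ofReal_mul (by positivity), ENNReal.ofReal_add (by positivity) (by norm_num),
        ENNReal.ofReal_mul (by positivity)]
      simp
    have h2 : (16 : ENNReal)⁻¹ = ENNReal.ofReal 16⁻¹ := by
      rw [ENNReal.ofReal_inv_of_pos (by norm_num)]
      simp
    rw [h1, h2]
    refine ENNReal.ofReal_le_ofReal ?_
    linarith
  · rw [one_div, ENNReal.ofReal_inv_of_pos (by norm_num)]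
    simp
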